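/- Let $K$ be a field, let $R=K[[x_1,\dots,x_n]]$ with maximal ideal $\mathfrak m$, and let $I_1,\dots,I_r$ be monomial ideals of finite colength in $R$ (that is, each $I_j$ is generated by monomials and $\dim_K R/I_j<\infty$). Let $G(I_1,\dots,I_r)$ be the group of $K$-algebra automorphisms $g$ of $R$ such that $g(I_j)=I_j$ for all $j$; it acts on the $K$-vector space $\mathfrak m/\mathfrak m^2$. Consider the decompositions $\mathfrak m/\mathfrak m^2=W_1\oplus\dots\oplus W_m$ into nonzero subspaces, each spanned by monomials (i.e. by classes of some of the variables $x_1,\dots,x_n$), such that for every $i$ and every $g\in G(I_1,\dots,I_r)$ there is an integer $k\ge 1$ with $g^k(W_1\oplus\dots\oplus W_i)=W_1\oplus\dots\oplus W_i$. Let $W_1\oplus\dots\oplus W_m$ be such a decomposition with the number $m$ of summands as large as possible. Then every $K$-algebra automorphism $g$ of $R$ that preserves degrees (it maps homogeneous elements of degree $d$ to homogeneous elements of degree $d$, for every $d$) and satisfies $g(W_i)=W_i$ for all $i$ belongs to $G(I_1,\dots,I_r)$. -/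

import Mathlib

namespace Alignment

variable (n : ℕ) (K : Type*) [Field K]

/-- The power series ring `R = K[[x_1, …, x_n]]`. -/
abbrev PS := MvPowerSeries (Fin n) K

/-- The maximal ideal of `R`. -/
noncomputable abbrev maxIdeal : Ideal (PS n K) := IsLocalRing.maximalIdeal (PS n K)

/-- The `K`-vector space `𝔪 / 𝔪 ^ 2`. -/
abbrev Cot := (maxIdeal n K).Cotangent

variable {n K}

/-- A monomial ideal: an ideal generated by a set of monomials `x ^ α`. -/
def IsMonomialIdeal (I : Ideal (PS n K)) : Prop :=
  ∃ S : Set (Fin n →₀ ℕ), I = Ideal.span ((fun α => MvPowerSeries.monomial α (1 : K)) '' S)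

/-- Finite colength: `R / I` is a finite-dimensional `K`-vector space. -/
def HasFiniteColength (I : Ideal (PS n K)) : Prop :=
  Module.Finite K (PS n K ⧸ I)

/-- The group `G(I_1, …, I_r)` of those `K`-algebra automorphisms `g` of `R` that
satisfy `g(I_j) = I_j` for all `j`. -/
def idealStabilizer {r : ℕ} (I : Fin r → Ideal (PS n K)) : Subgroup (PS n K ≃ₐ[K] PS n K) where
  carrier := {g | ∀ j, ∀ f, g f ∈ I j ↔ f ∈ I j}
  one_mem' := fun _ _ => Iff.rfl
  mul_mem' := fun {a b} ha hb j f => (ha j (b f)).trans (hb j f)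
  inv_mem' := fun {a} ha j f => by
    have h := ha j (a⁻¹ f)
    have e : a (a⁻¹ f) = f := a.apply_symm_apply f
    rw [e] at h
    exact h.symm

theorem X_mem_maxIdeal (j : Fin n) : (MvPowerSeries.X j : PS n K) ∈ maxIdeal n K := by
  rw [IsLocalRing.mem_maximalIdeal, mem_nonunits_iff, MvPowerSeries.isUnit_iff_constantCoeff]
  simp

theorem maxIdeal_le_comap (g : PS n K ≃ₐ[K] PS n K) :
    maxIdeal n K ≤ (maxIdeal n K).comap (g : PS n K →ₐ[K] PS n K) := by
  intro f hf
  rw [Ideal.mem_comap, IsLocalRing.mem_maximalIdeal, mem_nonunits_iff]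
  rw [IsLocalRing.mem_maximalIdeal, mem_nonunits_iff] at hf
  exact fun h => hf ((MulEquiv.isUnit_map g).1 h)

/-- The class of the variable `x_j` in `𝔪 / 𝔪 ^ 2`. -/
noncomputable def varClass (j : Fin n) : Cot n K :=
  (maxIdeal n K).toCotangent ⟨MvPowerSeries.X j, X_mem_maxIdeal j⟩

/-- The `K`-linear map induced on `𝔪 / 𝔪 ^ 2` by an automorphism of `R`. -/
noncomputable def cotMap (g : PS n K ≃ₐ[K] PS n K) : Cot n K →ₗ[K] Cot n K :=
  Ideal.mapCotangent (maxIdeal n K) (maxIdeal n K) (g : PS n K →ₐ[K] PS n K) (maxIdeal_le_comap g)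

/-- `g` fixes the subspace `V` of `𝔪 / 𝔪 ^ 2` (as a subspace): `g(V) = V`. -/
def Fixes (g : PS n K ≃ₐ[K] PS n K) (V : Submodule K (Cot n K)) : Prop :=
  V.map (cotMap g) = V

/-- `g` maps forms of degree `d` to forms of degree `d`, for every `d`. -/
def IsDegreePreserving (g : PS n K ≃ₐ[K] PS n K) : Prop :=
  ∀ (d : ℕ) (f : PS n K), f.IsHomogeneous d → (g f).IsHomogeneous d

/-- The decompositions `𝔪 / 𝔪 ^ 2 = W_1 ⊕ … ⊕ W_m` into nontrivial summands spanned by monomials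
(that is, by classes of variables, as monomials of higher degree vanish in `𝔪 / 𝔪 ^ 2`)
such that each partial sum `W_1 ⊕ … ⊕ W_i` is fixed by some
positive power of every element of `G(I_1, …, I_r)`. -/
structure IsAdapted {r : ℕ} (I : Fin r → Ideal (PS n K)) {m : ℕ}
    (W : Fin m → Submodule K (Cot n K)) : Prop where
  isInternal : DirectSum.IsInternal W
  ne_bot : ∀ i, W i ≠ ⊥
  spanned : ∀ i, ∃ S : Set (Fin n), W i = Submodule.span K (varClass '' S)
  partialSum_fixed : ∀ i, ∀ g ∈ idealStabilizer I, ∃ k : ℕ, 0 < k ∧ Fixes (g ^ k) (⨆ j ≤ i, W j)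

end Alignment

/-! A monomial ideal is determined by its set `S` of exponents. Comparing lowest-degree terms shows
that the linear part of any `g` in the stabilizer preserves `S` (`preservesExps_linMatrix`). The
question is therefore about matrices acting by linear substitution.

Write a → b when the substitution x_a ↦ x_a + s x_b, with s an indeterminate, preserves the
exponents of each of the ideals. Commutators of transvections make this a preorder
(`MovesTo.trans`). If `A` is the linear part of `g` and `B` its inverse, then A(1 + sE_qq)B = 1 +
s·(column q of A)(row q of B) preserves `S`. Degenerating along a torus isolates one entry, so A_pq
≠ 0 and B_qp' ≠ 0 force p → p' (`movesTo_of_conj`). Consequently `g` sends the span of an upward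
closed set of variables to a coordinate subspace. There are finitely many coordinate subspaces, so
some positive power of `g` fixes that span (`powFixes_of_closed`).

If some summand of a maximal decomposition contained x_a and x_c without a → c, the upward closure
of a would split that summand and lengthen the decomposition (`movesTo_of_level_eq`). Hence all
variables within a summand move to each other. A matrix that respects the blocks is a product of
diagonal matrices and transvections inside blocks, all of which preserve `S`
(`preservesExps_of_blockDiagonal`). Finite colength turns g(I) ⊆ I into equality. -/

namespace Alignment

/-! ### Linear substitutions and the sets of exponents they preserve. -/

section LinearSubstitution

variable {σ R R' : Type*} [Fintype σ] [CommRing R] [CommRing R']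

/-- The linear substitution `x_a ↦ ∑ b, A a b • x_b`. -/
noncomputable def linSubst (A : Matrix σ σ R) : MvPolynomial σ R →ₐ[R] MvPolynomial σ R :=
  MvPolynomial.aeval fun a => ∑ b, MvPolynomial.C (A a b) * MvPolynomial.X b

theorem linSubst_X (A : Matrix σ σ R) (a : σ) :
    linSubst A (MvPolynomial.X a) = ∑ b, MvPolynomial.C (A a b) * MvPolynomial.X b := by
  simp [linSubst]

/-- The linear substitution given by `A` preserves the polynomials with exponents in `S`. -/
def PreservesExps (S : Set (σ →₀ ℕ)) (A : Matrix σ σ R) : Prop :=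
  ∀ f ∈ MvPolynomial.restrictSupport R S, linSubst A f ∈ MvPolynomial.restrictSupport R S

theorem preservesExps_iff_monomial {S : Set (σ →₀ ℕ)} {A : Matrix σ σ R} :
    PreservesExps S A ↔ ∀ α ∈ S, ∀ β,
      MvPolynomial.coeff β (linSubst A (MvPolynomial.monomial α 1)) ≠ 0 → β ∈ S := by
  constructor
  · intro h α hα β hβ
    have := h (MvPolynomial.monomial α 1)
      ((MvPolynomial.monomial_mem_restrictSupport R).2 (Or.inl hα))
    exact (MvPolynomial.mem_restrictSupport_iff R).1 this (MvPolynomial.mem_support_iff.2 hβ)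
  · intro h f hf
    rw [MvPolynomial.restrictSupport_eq_span] at hf
    induction hf using Submodule.span_induction with
    | mem x hx =>
      obtain ⟨α, hα, rfl⟩ := hx
      exact fun β hβ => h α hα β (MvPolynomial.mem_support_iff.1 hβ)
    | zero => simp
    | add x y _ _ hx hy => rw [map_add]; exact add_mem hx hy
    | smul c x _ hx => rw [map_smul]; exact Submodule.smul_mem _ c hx

/-- Row a of the matrix is the image of x_a, so composition reverses the order of the factors. -/
theorem linSubst_mul (A B : Matrix σ σ R) (f : MvPolynomial σ R) :
    linSubst (A * B) f = linSubst B (linSubst A f) := by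
  have : linSubst (A * B) = (linSubst B).comp (linSubst A) := by
    ext1 a
    simp only [AlgHom.comp_apply, linSubst_X, map_sum, map_mul, Matrix.mul_apply,
      MvPolynomial.algHom_C, Finset.mul_sum, Finset.sum_mul, MvPolynomial.algebraMap_eq]
    rw [Finset.sum_comm]
    exact Finset.sum_congr rfl fun b _ => Finset.sum_congr rfl fun c _ => by ring
  rw [this]; rfl

theorem PreservesExps.mul {S : Set (σ →₀ ℕ)} {A B : Matrix σ σ R}
    (hA : PreservesExps S A) (hB : PreservesExps S B) : PreservesExps S (A * B) := by
  intro f hf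
  rw [linSubst_mul]
  exact hB _ (hA _ hf)

theorem map_linSubst (φ : R →+* R') (A : Matrix σ σ R) (f : MvPolynomial σ R) :
    linSubst (A.map φ) (MvPolynomial.map φ f) = MvPolynomial.map φ (linSubst A f) := by
  induction f using MvPolynomial.induction_on with
  | C r => simp [MvPolynomial.algHom_C]
  | add p q hp hq => simp [hp, hq]
  | mul_X p a hp => simp [hp, linSubst_X]

theorem PreservesExps.map {S : Set (σ →₀ ℕ)} {A : Matrix σ σ R} (hA : PreservesExps S A)
    (φ : R →+* R') : PreservesExps S (A.map φ) := by
  rw [preservesExps_iff_monomial] at hA ⊢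
  intro α hα β hβ
  refine hA α hα β fun h => hβ ?_
  have : MvPolynomial.monomial α (1 : R') = MvPolynomial.map φ (MvPolynomial.monomial α 1) := by
    simp
  rw [this, map_linSubst, MvPolynomial.coeff_map, h, map_zero]

variable [DecidableEq σ]

theorem linSubst_diagonal_monomial (d : σ → R) (α : σ →₀ ℕ) (c : R) :
    linSubst (Matrix.diagonal d) (MvPolynomial.monomial α c) =
      MvPolynomial.monomial α ((α.prod fun a k => d a ^ k) * c) := by
  have h : ∀ a, linSubst (Matrix.diagonal d) (MvPolynomial.X a) =
      MvPolynomial.C (d a) * MvPolynomial.X a := by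
    intro a
    rw [linSubst_X, Finset.sum_eq_single a]
    · simp
    · intro b _ hb
      simp [Matrix.diagonal_apply_ne' _ hb]
    · simp
  rw [MvPolynomial.monomial_eq, map_mul, MvPolynomial.algHom_C, MvPolynomial.monomial_eq]
  simp only [Finsupp.prod, map_prod, map_pow, h, mul_pow, Finset.prod_mul_distrib, map_mul,
    MvPolynomial.algebraMap_eq]
  ring

theorem coeff_linSubst_diagonal (d : σ → R) (f : MvPolynomial σ R) (β : σ →₀ ℕ) :
    MvPolynomial.coeff β (linSubst (Matrix.diagonal d) f) =
      (β.prod fun a k => d a ^ k) * MvPolynomial.coeff β f := by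
  induction f using MvPolynomial.monomial_add_induction_on with
  | C a =>
    rw [← MvPolynomial.monomial_zero', linSubst_diagonal_monomial]
    simp only [MvPolynomial.coeff_monomial]
    split_ifs with h
    · subst h; simp
    · simp
  | monomial_add α c f _ _ ih =>
    rw [map_add, MvPolynomial.coeff_add, ih, linSubst_diagonal_monomial, MvPolynomial.coeff_add,
      mul_add]
    simp only [MvPolynomial.coeff_monomial]
    split_ifs with h <;> simp [h]

theorem PreservesExps.diagonal (S : Set (σ →₀ ℕ)) (d : σ → R) :
    PreservesExps S (Matrix.diagonal d) := by
  rw [preservesExps_iff_monomial]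
  intro α hα β hβ
  rw [linSubst_diagonal_monomial, MvPolynomial.coeff_monomial] at hβ
  by_cases h : α = β
  · exact h ▸ hα
  · simp [h] at hβ

theorem PreservesExps.one (S : Set (σ →₀ ℕ)) : PreservesExps S (1 : Matrix σ σ R) := by
  rw [← Matrix.diagonal_one]
  exact .diagonal S _

/-- Diagonal factors only rescale coefficients of images of monomials, by nonzero elements of a
domain. Supports do not change. -/
theorem PreservesExps.of_diagonal_mul_mul_diagonal [IsDomain R] {S : Set (σ →₀ ℕ)}
    {d e : σ → R} {B : Matrix σ σ R} (hd : ∀ a, d a ≠ 0) (he : ∀ a, e a ≠ 0)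
    (h : PreservesExps S (Matrix.diagonal d * B * Matrix.diagonal e)) : PreservesExps S B := by
  rw [preservesExps_iff_monomial] at h ⊢
  intro α hα β hβ
  refine h α hα β ?_
  rw [linSubst_mul, coeff_linSubst_diagonal, linSubst_mul, linSubst_diagonal_monomial, mul_one]
  have : MvPolynomial.monomial α (α.prod fun a k => d a ^ k) =
      (α.prod fun a k => d a ^ k) • MvPolynomial.monomial α (1 : R) := by
    rw [MvPolynomial.smul_monomial, smul_eq_mul, mul_one]
  rw [this, map_smul, MvPolynomial.coeff_smul, smul_eq_mul]
  refine mul_ne_zero ?_ (mul_ne_zero ?_ hβ)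
  · exact Finset.prod_ne_zero_iff.2 fun a _ => pow_ne_zero _ (he a)
  · exact Finset.prod_ne_zero_iff.2 fun a _ => pow_ne_zero _ (hd a)

end LinearSubstitution

/-! ### Isolating one entry of a rank-one perturbation by a torus degeneration. -/

section Extraction

variable {σ K : Type*} [Fintype σ] [DecidableEq σ] [Field K]

open Polynomial in
/-- If `1 + s v w` preserves a set of exponents for an indeterminate `s`, then so does the
elementary matrix at each nonzero entry of `v w`. -/
theorem PreservesExps.transvection_of_vecMulVec {S : Set (σ →₀ ℕ)} {v w : σ → K} {p q : σ}
    (hp : v p ≠ 0) (hq : w q ≠ 0)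
    (h : PreservesExps S (1 + (X : K[X]) • (Matrix.vecMulVec v w).map C)) :
    PreservesExps S (1 + Matrix.single p q (X : K[X])) := by
  rcases eq_or_ne p q with rfl | hpq
  · have : (1 + Matrix.single p p (X : K[X])) =
        Matrix.diagonal (1 + Pi.single p (X : K[X])) := by
      rw [← Matrix.diagonal_single, ← Matrix.diagonal_one, Matrix.diagonal_add]
      rfl
    rw [this]
    exact .diagonal S _
  -- These are weights of a one-parameter torus, chosen so that 2 - δ i + δ j vanishes only at (i,
  -- j) = (p, q).
  let δ : σ → ℕ := fun i => if i = p then 2 else if i = q then 0 else 1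
  have hδ : ∀ i, δ i ≤ 2 := by intro i; simp only [δ]; split_ifs <;> omega
  -- The inner variable is s, the outer one t. `B` is 1 + s t² v w conjugated by the torus; the
  -- factor t² clears negative powers of t.
  let B : Matrix σ σ K[X][X] := 1 + Matrix.of fun i j =>
    C (X * C (v i * w j)) * X ^ (2 - δ i + δ j)
  have hBij : ∀ i j, B i j = (1 : Matrix σ σ K[X][X]) i j +
      C (X * C (v i * w j)) * X ^ (2 - δ i + δ j) := fun i j => Matrix.add_apply _ _ _ _
  have hB : PreservesExps S B := by
    refine .of_diagonal_mul_mul_diagonal (d := fun i => X ^ δ i) (e := fun j => X ^ (2 - δ j))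
      (fun _ => pow_ne_zero _ X_ne_zero) (fun _ => pow_ne_zero _ X_ne_zero) ?_
    have h1 := (h.map (eval₂RingHom ((C : K[X] →+* K[X][X]).comp C) (C X * X ^ 2))).mul
      (PreservesExps.diagonal S fun _ => (X : K[X][X]) ^ 2)
    convert h1 using 1
    refine Matrix.ext fun i j => ?_
    rw [Matrix.mul_diagonal, Matrix.diagonal_mul, Matrix.mul_diagonal, Matrix.map_apply,
      Matrix.add_apply, Matrix.smul_apply, Matrix.map_apply, Matrix.vecMulVec_apply, hBij]
    simp only [coe_eval₂RingHom, eval₂_add, smul_eq_mul, eval₂_mul, eval₂_X, eval₂_C,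
      RingHom.comp_apply, map_mul]
    have key : ∀ x a b p q r s t : K[X][X], p * q = t → r * s = t →
        p * (x * (a * b) * (q * r)) * s = x * t * (a * b) * t := by
      rintro x a b p q r s t rfl h
      linear_combination (p * q * x * a * b) * h
    have e1 : (X : K[X][X]) ^ δ i * X ^ (2 - δ i) = X ^ 2 := by
      rw [← pow_add, Nat.add_sub_cancel' (hδ i)]
    have e2 : (X : K[X][X]) ^ δ j * X ^ (2 - δ j) = X ^ 2 := by
      rw [← pow_add, Nat.add_sub_cancel' (hδ j)]
    have e3 : (X : K[X][X]) ^ δ i * (1 : Matrix σ σ K[X][X]) i j * X ^ (2 - δ j) =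
        (1 : Matrix σ σ K[X][X]) i j * X ^ 2 := by
      rcases eq_or_ne i j with rfl | hij
      · simp [e1]
      · simp [Matrix.one_apply_ne hij]
    have e4 : eval₂ ((C : K[X] →+* K[X][X]).comp C) (C X * X ^ 2) ((1 : Matrix σ σ K[X]) i j) =
        (1 : Matrix σ σ K[X][X]) i j := by
      rcases eq_or_ne i j with rfl | hij
      · simp
      · simp [Matrix.one_apply_ne hij]
    rw [e4, mul_add, add_mul, e3, pow_add, add_mul]
    refine congrArg₂ (· + ·) rfl ?_
    exact key _ _ _ _ _ _ _ _ e1 e2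
  -- Setting t = 0 leaves only the entry (p, q) of the perturbation, and rescaling s removes the
  -- constant v p * w q.
  have h0 := hB.map ((aeval (C (v p * w q)⁻¹ * X : K[X])).toRingHom.comp
    (evalRingHom (0 : K[X])))
  convert h0 using 1
  have hpq0 : v p * w q ≠ 0 := mul_ne_zero hp hq
  refine Matrix.ext fun i j => ?_
  have e1 : ((aeval (C (v p * w q)⁻¹ * X : K[X])).toRingHom.comp (evalRingHom (0 : K[X])))
      ((1 : Matrix σ σ K[X][X]) i j) = (1 : Matrix σ σ K[X]) i j := by
    rcases eq_or_ne i j with rfl | hij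
    · simp
    · simp [Matrix.one_apply_ne hij]
  rw [Matrix.map_apply, Matrix.add_apply, hBij, map_add, e1, Matrix.single_apply]
  congr 1
  split_ifs with hij
  · obtain ⟨rfl, rfl⟩ := hij
    have : 2 - δ p + δ q = 0 := by simp [δ, hpq.symm]
    simp only [this, pow_zero, mul_one, RingHom.comp_apply, coe_evalRingHom,
      eval_C, AlgHom.toRingHom_eq_coe, RingHom.coe_coe, map_mul, aeval_X, aeval_C]
    rw [mul_right_comm, ← map_mul, Polynomial.algebraMap_eq, ← map_mul,
      inv_mul_cancel₀ hpq0, map_one, one_mul]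
  · have : 2 - δ i + δ j ≠ 0 := by
      intro h
      apply hij
      simp only [δ] at h
      split_ifs at h <;> simp_all
    rw [RingHom.comp_apply, map_mul, map_pow, coe_evalRingHom, eval_X, zero_pow this, mul_zero,
      map_zero]

end Extraction

end Alignment

namespace Alignment

/-! ### The preorder of moves between variables, and block diagonal matrices. -/

section Transvections

variable {σ K : Type*} [Fintype σ] [DecidableEq σ] [Field K]

/-- The substitution `x_a ↦ x_a + s x_b`, for an indeterminate `s`, preserves the exponents `S`. -/
def MovesTo (K : Type*) [Field K] (S : Set (σ →₀ ℕ)) (a b : σ) : Prop :=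
  PreservesExps S (1 + Matrix.single a b (Polynomial.X : Polynomial K))

theorem MovesTo.refl (S : Set (σ →₀ ℕ)) (a : σ) : MovesTo K S a a := by
  have : (1 + Matrix.single a a (Polynomial.X : Polynomial K)) =
      Matrix.diagonal (1 + Pi.single a (Polynomial.X : Polynomial K)) := by
    rw [← Matrix.diagonal_single, ← Matrix.diagonal_one, Matrix.diagonal_add]
    rfl
  unfold MovesTo
  rw [this]
  exact .diagonal S _

/-- The indeterminate specializes to any element of any commutative `K`-algebra. -/
theorem MovesTo.preservesExps {R : Type*} [CommRing R] [Algebra K R] {S : Set (σ →₀ ℕ)} {a b : σ}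
    (h : MovesTo K S a b) (c : R) : PreservesExps S (1 + Matrix.single a b c) := by
  have := h.map (Polynomial.aeval c).toRingHom
  convert this using 1
  refine Matrix.ext fun i j => ?_
  rw [Matrix.map_apply, Matrix.add_apply, Matrix.add_apply, map_add, Matrix.single_apply,
    Matrix.single_apply, Matrix.one_apply, Matrix.one_apply]
  split_ifs <;> simp

theorem MovesTo.trans {S : Set (σ →₀ ℕ)} {a b c : σ}
    (hab : MovesTo K S a b) (hbc : MovesTo K S b c) : MovesTo K S a c := by
  rcases eq_or_ne a b with rfl | h1
  · exact hbc
  rcases eq_or_ne b c with rfl | h2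
  · exact hab
  rcases eq_or_ne a c with rfl | h3
  · exact .refl S a
  -- For distinct indices, the commutator of 1 + sE_ab and 1 + E_bc is 1 + sE_ac.
  have h := ((hab.preservesExps (Polynomial.X : Polynomial K)).mul
    (hbc.preservesExps (1 : Polynomial K))).mul
    ((hab.preservesExps (-Polynomial.X : Polynomial K)).mul
    (hbc.preservesExps (-1 : Polynomial K)))
  have hneg : ∀ (i j : σ) (x : Polynomial K), Matrix.single i j (-x) = -Matrix.single i j x := by
    intro i j x
    refine Matrix.ext fun i' j' => ?_
    rw [Matrix.neg_apply, Matrix.single_apply, Matrix.single_apply]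
    split_ifs <;> simp
  unfold MovesTo
  convert h using 1
  simp only [hneg, mul_add, add_mul, one_mul, mul_one, Matrix.single_mul_single_same,
    Matrix.single_mul_single_of_ne _ _ _ _ h1.symm, Matrix.single_mul_single_of_ne _ _ _ _ h2.symm,
    Matrix.single_mul_single_of_ne _ _ _ _ h3.symm, mul_neg, neg_mul]
  abel

/-- The diagonal matrix 1 + sE_qq preserves every set of exponents. Its conjugate by `A` is a
rank-one perturbation of 1, to which the extraction lemma applies. -/
theorem movesTo_of_conj {S : Set (σ →₀ ℕ)} {A B : Matrix σ σ K} (hAB : A * B = 1)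
    (hA : PreservesExps S A) (hB : PreservesExps S B) {p q p' : σ}
    (hp : A p q ≠ 0) (hq : B q p' ≠ 0) : MovesTo K S p p' := by
  refine PreservesExps.transvection_of_vecMulVec (v := fun i => A i q) (w := B q) hp hq ?_
  have h := ((hA.map Polynomial.C).mul
    ((MovesTo.refl (K := K) S q).preservesExps (Polynomial.X : Polynomial K))).mul (hB.map Polynomial.C)
  convert h using 1
  rw [mul_add, mul_one, add_mul, ← Matrix.map_mul, hAB, Matrix.map_one _ (map_zero _) (map_one _)]
  congr 1
  refine Matrix.ext fun i j => ?_
  rw [Matrix.mul_apply, Finset.sum_eq_single q]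
  · simp [Matrix.vecMulVec_apply]
    ring
  · intro b _ hb
    rw [Matrix.mul_single_apply_of_ne _ _ _ _ _ hb, zero_mul]
  · simp

/-- A matrix that is block diagonal with respect to `ℓ` preserves the exponents `S`, if within each
block all variables move to each other. -/
theorem preservesExps_of_blockDiagonal {S : Set (σ →₀ ℕ)} {τ : Type*} [Fintype τ] [DecidableEq τ]
    (ℓ : σ → τ) (hℓ : ∀ a b, ℓ a = ℓ b → MovesTo K S a b) {A : Matrix σ σ K}
    (hA : ∀ a b, A a b ≠ 0 → ℓ a = ℓ b) : PreservesExps S A := by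
  -- Only the blocks labelled in `s` are kept, the other rows being those of 1; `A` is then the
  -- product of its single-block parts.
  let part : Finset τ → Matrix σ σ K := fun s => Matrix.of fun a b =>
    if ℓ a ∈ s then A a b else (1 : Matrix σ σ K) a b
  have hpart : ∀ s a b, part s a b = if ℓ a ∈ s then A a b else (1 : Matrix σ σ K) a b :=
    fun s a b => rfl
  have hsingle : ∀ t, PreservesExps S (part {t}) := by
    intro t
    let e := Equiv.sumCompl fun a => ℓ a = t
    let emb : Matrix {a // ℓ a = t} {a // ℓ a = t} K → Matrix σ σ K := fun B =>
      (Matrix.fromBlocks B 0 0 1).submatrix e.symm e.symm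
    have hemb_in : ∀ B (i j : {a // ℓ a = t}), emb B i j = B i j := by
      intro B i j
      simp [emb, e]
    have hemb_out : ∀ B (i : σ), ℓ i ≠ t → ∀ j, emb B i j = (1 : Matrix σ σ K) i j := by
      intro B i hi j
      by_cases hj : ℓ j = t
      · have : i ≠ j := fun h => hi (h ▸ hj)
        simp [emb, e, Equiv.sumCompl_symm_apply_of_pos, Equiv.sumCompl_symm_apply_of_neg, hi, hj,
          this]
      · simp [emb, e, Equiv.sumCompl_symm_apply_of_neg, hi, hj, Matrix.one_apply]
    have hemb_mid : ∀ B (i : σ), ℓ i = t → ∀ j, ℓ j ≠ t → emb B i j = 0 := by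
      intro B i hi j hj
      simp [emb, e, Equiv.sumCompl_symm_apply_of_pos, Equiv.sumCompl_symm_apply_of_neg, hi, hj]
    have key : ∀ B, PreservesExps S (emb B) := by
      intro B
      -- Gaussian elimination inside one block; invertibility is not needed, as diagonal matrices
      -- may have zero entries.
      refine Matrix.diagonal_transvection_induction (fun B => PreservesExps S (emb B)) B ?_ ?_ ?_
      · intro D _
        have : emb (Matrix.diagonal D) =
            Matrix.diagonal (Sum.elim D 1 ∘ e.symm) := by
          simp only [emb]
          rw [← Matrix.diagonal_one, Matrix.fromBlocks_diagonal, Matrix.submatrix_diagonal_equiv]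
          rfl
        rw [this]
        exact .diagonal S _
      · rintro ⟨i, j, hij, c⟩
        have : emb (Matrix.TransvectionStruct.toMatrix ⟨i, j, hij, c⟩) =
            1 + Matrix.single (i : σ) (j : σ) c := by
          refine Matrix.ext fun a b => ?_
          by_cases ha : ℓ a = t
          · by_cases hb : ℓ b = t
            · lift a to {a // ℓ a = t} using ha
              lift b to {a // ℓ a = t} using hb
              rw [hemb_in]
              simp [Matrix.TransvectionStruct.toMatrix, Matrix.transvection, Matrix.single_apply,
                Matrix.one_apply, Subtype.ext_iff]
            · have h1 : a ≠ b := fun h => hb (h ▸ ha)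
              have h2 : (j : σ) ≠ b := fun h => hb (h ▸ j.2)
              simp [hemb_mid _ a ha b hb, h1, h2]
          · have h2 : (i : σ) ≠ a := fun h => ha (h ▸ i.2)
            simp [hemb_out _ a ha b, h2]
        rw [this]
        exact (hℓ i j (i.2.trans j.2.symm)).preservesExps c
      · intro B C hB hC
        have : emb (B * C) = emb B * emb C := by
          simp [emb, Matrix.submatrix_mul_equiv, Matrix.fromBlocks_multiply]
        rw [this]
        exact hB.mul hC
    have : part {t} = emb (Matrix.of fun i j => A i j) := by
      refine Matrix.ext fun a b => ?_
      rw [hpart]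
      by_cases ha : ℓ a = t
      · by_cases hb : ℓ b = t
        · lift a to {a // ℓ a = t} using ha
          lift b to {a // ℓ a = t} using hb
          rw [hemb_in]
          simp [a.2]
        · rw [hemb_mid _ a ha b hb]
          simp only [Finset.mem_singleton, ha, if_true]
          by_contra h
          exact hb ((hA a b h).symm.trans ha)
      · rw [hemb_out _ a ha b]
        simp [ha]
    rw [this]
    exact key _
  have hall : ∀ s, PreservesExps S (part s) := by
    intro s
    induction s using Finset.induction_on with
    | empty =>
      have : part ∅ = 1 := by
        refine Matrix.ext fun a b => ?_
        simp [hpart]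
      rw [this]
      exact .one S
    | insert t s ht ih =>
      have : part (insert t s) = part {t} * part s := by
        refine Matrix.ext fun a b => ?_
        rw [Matrix.mul_apply]
        by_cases ha : ℓ a = t
        · rw [Finset.sum_eq_single b]
          · have h1 : part s b b = 1 ∨ A a b = 0 := by
              by_cases h : A a b = 0
              · exact Or.inr h
              · left
                rw [hpart, ← hA a b h, ha, if_neg ht, Matrix.one_apply_eq]
            simp only [hpart {t}, hpart (insert t s), Finset.mem_insert, Finset.mem_singleton, ha,
              true_or, if_true]
            rcases h1 with h1 | h1 <;> simp [h1]
          · intro c _ hc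
            rw [hpart, hpart]
            simp only [Finset.mem_singleton, ha, if_true]
            by_cases h : A a c = 0
            · simp [h]
            · rw [← hA a c h, ha, if_neg ht, Matrix.one_apply_ne hc, mul_zero]
          · simp
        · rw [Finset.sum_eq_single a]
          · simp [hpart, ha]
          · intro c _ hc
            simp [hpart, ha, Matrix.one_apply_ne hc.symm]
          · simp
      rw [this]
      exact (hsingle t).mul ih
  have : part Finset.univ = A := by
    refine Matrix.ext fun a b => ?_
    simp [hpart]
  exact this ▸ hall Finset.univ

end Transvections

end Alignment

namespace Alignment

/-! ### Membership in monomial ideals of power series. -/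

section MonomialIdeals

variable {n : ℕ} {K : Type*} [Field K]

/-- A power series each of whose exponents dominates an element of a finite set of exponents is in
the ideal generated by the corresponding monomials. -/
theorem mem_span_monomial_of_finset (Γ : Finset (Fin n →₀ ℕ)) (f : PS n K)
    (hf : ∀ β, MvPowerSeries.coeff β f ≠ 0 → ∃ γ ∈ Γ, γ ≤ β) :
    f ∈ Ideal.span ((fun α => MvPowerSeries.monomial α (1 : K)) '' (Γ : Set (Fin n →₀ ℕ))) := by
  classical
  induction Γ using Finset.induction_on generalizing f with
  | empty =>
    have : f = 0 := by
      ext β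
      by_contra h
      obtain ⟨γ, hγ, _⟩ := hf β h
      simp at hγ
    rw [this]
    exact zero_mem _
  | insert γ Γ hγ ih =>
    -- The terms of `f` divisible by x^γ, divided by x^γ; what remains of `f` has no exponent above
    -- `γ`.
    let q : PS n K := fun β => MvPowerSeries.coeff (γ + β) f
    have hq : ∀ β, MvPowerSeries.coeff β q = MvPowerSeries.coeff (γ + β) f := fun β => rfl
    have hle : Ideal.span ((fun α => MvPowerSeries.monomial α (1 : K)) '' (Γ : Set (Fin n →₀ ℕ))) ≤
        Ideal.span ((fun α => MvPowerSeries.monomial α (1 : K)) ''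
          ((insert γ Γ : Finset _) : Set (Fin n →₀ ℕ))) :=
      Ideal.span_mono (Set.image_mono (by simp))
    have h1 : f - MvPowerSeries.monomial γ (1 : K) * q ∈
        Ideal.span ((fun α => MvPowerSeries.monomial α (1 : K)) '' (Γ : Set (Fin n →₀ ℕ))) := by
      refine ih _ fun β hβ => ?_
      rw [map_sub, MvPowerSeries.coeff_monomial_mul, one_mul, hq] at hβ
      by_cases h : γ ≤ β
      · rw [if_pos h, add_tsub_cancel_of_le h, sub_self] at hβ
        exact absurd rfl hβ
      · rw [if_neg h, sub_zero] at hβ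
        obtain ⟨γ', hγ', hle'⟩ := hf β hβ
        rcases Finset.mem_insert.1 hγ' with rfl | h'
        · exact absurd hle' h
        · exact ⟨γ', h', hle'⟩
    have h2 : MvPowerSeries.monomial γ (1 : K) * q ∈
        Ideal.span ((fun α => MvPowerSeries.monomial α (1 : K)) ''
          ((insert γ Γ : Finset _) : Set (Fin n →₀ ℕ))) :=
      Ideal.mul_mem_right _ _ (Ideal.subset_span ⟨γ, by simp, rfl⟩)
    have := add_mem (hle h1) h2
    rwa [sub_add_cancel] at this

theorem mem_span_monomial_iff (S : Set (Fin n →₀ ℕ)) (f : PS n K) :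
    f ∈ Ideal.span ((fun α => MvPowerSeries.monomial α (1 : K)) '' S) ↔
      ∀ β, MvPowerSeries.coeff β f ≠ 0 → ∃ γ ∈ S, γ ≤ β := by
  classical
  constructor
  · intro hf
    induction hf using Submodule.span_induction with
    | mem x hx =>
      obtain ⟨α, hα, rfl⟩ := hx
      intro β hβ
      exact ⟨α, hα, (MvPowerSeries.eq_of_coeff_monomial_ne_zero hβ).ge⟩
    | zero => simp
    | add x y _ _ hx hy =>
      intro β hβ
      rw [map_add] at hβ
      by_cases h : MvPowerSeries.coeff β x = 0
      · exact hy β (by simpa [h] using hβ)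
      · exact hx β h
    | smul c x _ hx =>
      intro β hβ
      rw [smul_eq_mul, MvPowerSeries.coeff_mul] at hβ
      obtain ⟨p, hp, hne⟩ := Finset.exists_ne_zero_of_sum_ne_zero hβ
      obtain ⟨γ, hγ, hle⟩ := hx p.2 (right_ne_zero_of_mul hne)
      refine ⟨γ, hγ, hle.trans ?_⟩
      rw [← Finset.HasAntidiagonal.mem_antidiagonal.1 hp]
      exact le_add_self
  · intro hf
    -- Dickson's lemma: `S` has finitely many minimal elements and they suffice. Finiteness matters
    -- because `f` may have infinitely many terms.
    have hpwo : S.IsPWO := Set.isPWO_of_wellQuasiOrderedLE S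
    have hfin : {γ | Minimal (· ∈ S) γ}.Finite :=
      (setOfPred_minimal_antichain (· ∈ S)).finite_of_partiallyWellOrderedOn
        (hpwo.mono fun γ hγ => hγ.1)
    have h := mem_span_monomial_of_finset hfin.toFinset f fun β hβ => by
      obtain ⟨γ, hγ, hle⟩ := hf β hβ
      obtain ⟨δ, hδ, hmin⟩ := hpwo.exists_le_minimal hγ
      exact ⟨δ, by simpa using hmin, hδ.trans hle⟩
    refine Ideal.span_mono (Set.image_mono ?_) h
    intro γ hγ
    have : Minimal (· ∈ S) γ := by simpa using hγ
    exact this.1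

/-- The exponents of the monomials in an ideal. -/
def exponents (I : Ideal (PS n K)) : Set (Fin n →₀ ℕ) :=
  {α | MvPowerSeries.monomial α (1 : K) ∈ I}

theorem IsMonomialIdeal.mem_iff {I : Ideal (PS n K)} (hI : IsMonomialIdeal I) (f : PS n K) :
    f ∈ I ↔ ∀ β, MvPowerSeries.coeff β f ≠ 0 → β ∈ exponents I := by
  classical
  obtain ⟨S, rfl⟩ := hI
  rw [mem_span_monomial_iff]
  refine forall_congr' fun β => imp_congr_right fun _ => ?_
  rw [exponents, Set.mem_ofPred_eq, mem_span_monomial_iff]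
  constructor
  · intro h β' hβ'
    rwa [MvPowerSeries.eq_of_coeff_monomial_ne_zero hβ']
  · intro h
    exact h β (by simp)

end MonomialIdeals

/-! ### The variables as a basis of the cotangent space. -/

section Cotangent

variable {n : ℕ} {K : Type*} [Field K]

theorem mem_maxIdeal_iff (f : PS n K) : f ∈ maxIdeal n K ↔ MvPowerSeries.coeff 0 f = 0 := by
  rw [IsLocalRing.mem_maximalIdeal, mem_nonunits_iff, MvPowerSeries.isUnit_iff_constantCoeff,
    isUnit_iff_ne_zero, not_not, MvPowerSeries.coeff_zero_eq_constantCoeff_apply]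

theorem mem_maxIdeal_sq {f : PS n K} (h0 : MvPowerSeries.coeff 0 f = 0)
    (h1 : ∀ b, MvPowerSeries.coeff (Finsupp.single b 1) f = 0) : f ∈ maxIdeal n K ^ 2 := by
  have h := (mem_span_monomial_iff (K := K)
    {γ : Fin n →₀ ℕ | ∃ a b, γ = Finsupp.single a 1 + Finsupp.single b 1} f).2 (by
      intro β hβ
      have hβ0 : β ≠ 0 := by rintro rfl; exact hβ h0
      obtain ⟨a, ha⟩ := Finsupp.ne_iff.1 hβ0
      have ha' : Finsupp.single a 1 ≤ β := by
        rw [Finsupp.single_le_iff]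
        exact Nat.one_le_iff_ne_zero.2 ha
      have hβ1 : β - Finsupp.single a 1 ≠ 0 := by
        intro h
        refine hβ ?_
        rw [← tsub_add_cancel_of_le ha', h, zero_add]
        exact h1 a
      obtain ⟨b, hb⟩ := Finsupp.ne_iff.1 hβ1
      have hb' : Finsupp.single b 1 ≤ β - Finsupp.single a 1 := by
        rw [Finsupp.single_le_iff]
        exact Nat.one_le_iff_ne_zero.2 hb
      refine ⟨_, ⟨a, b, rfl⟩, ?_⟩
      have := add_le_add_right hb' (Finsupp.single a 1)
      rwa [add_tsub_cancel_of_le ha'] at this)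
  refine Ideal.span_le.2 ?_ h
  rintro _ ⟨_, ⟨a, b, rfl⟩, rfl⟩
  have : MvPowerSeries.monomial (Finsupp.single a 1 + Finsupp.single b 1) (1 : K) =
      MvPowerSeries.X a * MvPowerSeries.X b := by
    rw [MvPowerSeries.X_def, MvPowerSeries.X_def, MvPowerSeries.monomial_mul_monomial, one_mul]
  simp only [SetLike.mem_coe, this, sq]
  exact Ideal.mul_mem_mul (X_mem_maxIdeal a) (X_mem_maxIdeal b)

theorem coeff_single_mul_of_coeff_zero {f g : PS n K} (hf : MvPowerSeries.coeff 0 f = 0)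
    (hg : MvPowerSeries.coeff 0 g = 0) (b : Fin n) :
    MvPowerSeries.coeff (Finsupp.single b 1) (f * g) = 0 := by
  classical
  rw [MvPowerSeries.coeff_mul]
  refine Finset.sum_eq_zero fun p hp => ?_
  have hp' := Finset.HasAntidiagonal.mem_antidiagonal.1 hp
  by_cases h : p.1 = 0
  · rw [h, hf, zero_mul]
  · have hd := congrArg Finsupp.degree hp'
    rw [map_add, Finsupp.degree_single] at hd
    have : p.1.degree ≠ 0 := fun h' => h ((Finsupp.degree_eq_zero_iff _).1 h')
    have h2 : p.2 = 0 := (Finsupp.degree_eq_zero_iff _).1 (by omega)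
    rw [h2, hg, mul_zero]

/-- The coefficients of the linear terms, as a map on `𝔪 / 𝔪 ^ 2`. -/
noncomputable def linCoeff : Cot n K →ₗ[K] (Fin n → K) :=
  Ideal.Cotangent.lift
    (LinearMap.pi (fun b => MvPowerSeries.coeff (R := K) (Finsupp.single b 1)) ∘ₗ
      ((maxIdeal n K).restrictScalars K).subtype) (by
    intro x y
    ext b
    exact coeff_single_mul_of_coeff_zero ((mem_maxIdeal_iff _).1 x.2) ((mem_maxIdeal_iff _).1 y.2) b)

theorem linCoeff_toCotangent (x : maxIdeal n K) (b : Fin n) :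
    linCoeff ((maxIdeal n K).toCotangent x) b =
      MvPowerSeries.coeff (Finsupp.single b 1) (x : PS n K) := rfl

theorem linCoeff_varClass (a : Fin n) : linCoeff (varClass a : Cot n K) = Pi.single a 1 := by
  ext b
  rw [varClass, linCoeff_toCotangent, MvPowerSeries.coeff_index_single_X, Pi.single_apply]

theorem linCoeff_bijective : Function.Bijective (linCoeff (n := n) (K := K)) := by
  constructor
  · rw [injective_iff_map_eq_zero]
    intro x hx
    obtain ⟨x, rfl⟩ := (maxIdeal n K).toCotangent_surjective x
    rw [Ideal.toCotangent_eq_zero]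
    exact mem_maxIdeal_sq ((mem_maxIdeal_iff _).1 x.2) fun b => congrFun hx b
  · intro c
    refine ⟨∑ a, c a • varClass a, ?_⟩
    simp only [map_sum, map_smul, linCoeff_varClass]
    ext b
    simp [Finset.sum_apply, Pi.single_apply]

/-- The classes of the variables form a basis of `𝔪 / 𝔪 ^ 2`. -/
noncomputable def varBasis : Module.Basis (Fin n) K (Cot n K) :=
  Module.Basis.ofEquivFun (LinearEquiv.ofBijective linCoeff linCoeff_bijective)

theorem varBasis_apply (a : Fin n) : varBasis a = (varClass a : Cot n K) := by
  apply linCoeff_bijective.1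
  rw [linCoeff_varClass, varBasis, Module.Basis.coe_ofEquivFun]
  exact (LinearEquiv.ofBijective (linCoeff (n := n) (K := K)) linCoeff_bijective).apply_symm_apply
    (Pi.single a 1)

theorem coe_varBasis : ⇑(varBasis : Module.Basis (Fin n) K (Cot n K)) = varClass :=
  funext varBasis_apply

theorem varBasis_repr (x : Cot n K) (b : Fin n) : varBasis.repr x b = linCoeff x b := by
  simp [varBasis]

end Cotangent

/-! ### Linear parts of automorphisms and their action on monomial ideals. -/

section LinearPart

variable {n : ℕ} {K : Type*} [Field K]

/-- The matrix of the linear part of an automorphism. -/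
noncomputable def linMatrix (g : PS n K ≃ₐ[K] PS n K) : Matrix (Fin n) (Fin n) K :=
  Matrix.of fun a b => MvPowerSeries.coeff (Finsupp.single b 1) (g (MvPowerSeries.X a))

theorem linCoeff_cotMap_varClass (g : PS n K ≃ₐ[K] PS n K) (a b : Fin n) :
    linCoeff (cotMap g (varClass a)) b = linMatrix g a b := rfl

theorem cotMap_varClass (g : PS n K ≃ₐ[K] PS n K) (a : Fin n) :
    cotMap g (varClass a) = ∑ b, linMatrix g a b • varClass b := by
  apply linCoeff_bijective.1
  ext c
  rw [linCoeff_cotMap_varClass]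
  simp [linCoeff_varClass, Finset.sum_apply, Pi.single_apply]

theorem cotMap_mul (g h : PS n K ≃ₐ[K] PS n K) : cotMap (g * h) = cotMap g ∘ₗ cotMap h := by
  ext x
  obtain ⟨x, rfl⟩ := (maxIdeal n K).toCotangent_surjective x
  rfl

theorem cotMap_one : cotMap (1 : PS n K ≃ₐ[K] PS n K) = LinearMap.id := by
  ext x
  obtain ⟨x, rfl⟩ := (maxIdeal n K).toCotangent_surjective x
  rfl

theorem linMatrix_mul (g h : PS n K ≃ₐ[K] PS n K) :
    linMatrix (g * h) = linMatrix h * linMatrix g := by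
  refine Matrix.ext fun a b => ?_
  rw [← linCoeff_cotMap_varClass, cotMap_mul, LinearMap.comp_apply, cotMap_varClass h]
  simp [linCoeff_cotMap_varClass, Finset.sum_apply, Matrix.mul_apply]

theorem linMatrix_one : linMatrix (1 : PS n K ≃ₐ[K] PS n K) = 1 := by
  refine Matrix.ext fun a b => ?_
  rw [← linCoeff_cotMap_varClass, cotMap_one, LinearMap.id_apply, linCoeff_varClass,
    Pi.single_apply, Matrix.one_apply]
  simp only [eq_comm]

/-- `f` and `p` have no terms of degree less than `d`, and the same terms of degree `d`. -/
def SameLeading (d : ℕ) (f p : PS n K) : Prop :=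
  (∀ β : Fin n →₀ ℕ, β.degree < d →
    MvPowerSeries.coeff β f = 0 ∧ MvPowerSeries.coeff β p = 0) ∧
  ∀ β : Fin n →₀ ℕ, β.degree = d → MvPowerSeries.coeff β f = MvPowerSeries.coeff β p

theorem SameLeading.mul {d e : ℕ} {f p f' p' : PS n K} (h : SameLeading d f p)
    (h' : SameLeading e f' p') : SameLeading (d + e) (f * f') (p * p') := by
  classical
  constructor
  · intro β hβ
    rw [MvPowerSeries.coeff_mul, MvPowerSeries.coeff_mul]
    constructor <;> refine Finset.sum_eq_zero fun x hx => ?_ <;>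
    · have hd := congrArg Finsupp.degree (Finset.HasAntidiagonal.mem_antidiagonal.1 hx)
      rw [map_add] at hd
      rcases lt_or_ge x.1.degree d with h1 | h1
      · simp [h.1 _ h1]
      · simp [h'.1 x.2 (by omega)]
  · intro β hβ
    rw [MvPowerSeries.coeff_mul, MvPowerSeries.coeff_mul]
    refine Finset.sum_congr rfl fun x hx => ?_
    have hd := congrArg Finsupp.degree (Finset.HasAntidiagonal.mem_antidiagonal.1 hx)
    rw [map_add] at hd
    rcases lt_trichotomy x.1.degree d with h1 | h1 | h1
    · simp [h.1 _ h1]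
    · rw [h.2 _ h1, h'.2 x.2 (by omega)]
    · simp [h'.1 x.2 (by omega)]

theorem SameLeading.one : SameLeading 0 (1 : PS n K) 1 :=
  ⟨fun β hβ => absurd hβ (by simp), fun _ _ => rfl⟩

theorem SameLeading.pow {d : ℕ} {f p : PS n K} (h : SameLeading d f p) (k : ℕ) :
    SameLeading (k * d) (f ^ k) (p ^ k) := by
  induction k with
  | zero => simpa using SameLeading.one
  | succ k ih =>
    rw [pow_succ, pow_succ, Nat.succ_mul]
    exact ih.mul h

theorem SameLeading.prod {ι : Type*} (s : Finset ι) {d : ι → ℕ} {f p : ι → PS n K}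
    (h : ∀ i, SameLeading (d i) (f i) (p i)) :
    SameLeading (∑ i ∈ s, d i) (∏ i ∈ s, f i) (∏ i ∈ s, p i) := by
  classical
  induction s using Finset.induction_on with
  | empty => simpa using SameLeading.one
  | insert i s hi ih =>
    rw [Finset.sum_insert hi, Finset.prod_insert hi, Finset.prod_insert hi]
    exact (h i).mul ih

theorem map_monomial_eq_prod (g : PS n K ≃ₐ[K] PS n K) (α : Fin n →₀ ℕ) :
    g (MvPowerSeries.monomial α 1) = ∏ a, g (MvPowerSeries.X a) ^ α a := by
  rw [MvPowerSeries.monomial_one_eq, Finsupp.prod_fintype _ _ (fun _ => pow_zero _), map_prod]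
  simp only [map_pow]

theorem linSubst_monomial_eq_prod (A : Matrix (Fin n) (Fin n) K) (α : Fin n →₀ ℕ) :
    linSubst A (MvPolynomial.monomial α 1) = ∏ a, linSubst A (MvPolynomial.X a) ^ α a := by
  rw [MvPolynomial.monomial_eq, map_one, one_mul,
    Finsupp.prod_fintype _ _ (fun _ => pow_zero _), map_prod]
  simp only [map_pow]

theorem coe_linSubst_monomial_eq_prod (A : Matrix (Fin n) (Fin n) K) (α : Fin n →₀ ℕ) :
    ((linSubst A (MvPolynomial.monomial α 1) : MvPolynomial (Fin n) K) : PS n K) =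
      ∏ a, ((linSubst A (MvPolynomial.X a) : MvPolynomial (Fin n) K) : PS n K) ^ α a := by
  rw [linSubst_monomial_eq_prod, ← MvPolynomial.coeToMvPowerSeries.ringHom_apply, map_prod]
  simp only [map_pow, MvPolynomial.coeToMvPowerSeries.ringHom_apply]

theorem isHomogeneous_linSubst_X (A : Matrix (Fin n) (Fin n) K) (a : Fin n) :
    (linSubst A (MvPolynomial.X a)).IsHomogeneous 1 := by
  rw [linSubst_X]
  exact MvPolynomial.IsHomogeneous.sum _ _ _ fun b _ => MvPolynomial.isHomogeneous_C_mul_X _ _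

theorem isHomogeneous_linSubst_monomial (A : Matrix (Fin n) (Fin n) K) (α : Fin n →₀ ℕ) :
    (linSubst A (MvPolynomial.monomial α 1)).IsHomogeneous α.degree := by
  rw [linSubst_monomial_eq_prod, Finsupp.degree_eq_sum]
  exact MvPolynomial.IsHomogeneous.prod _ _ _ fun a _ => by
    simpa using (isHomogeneous_linSubst_X A a).pow (α a)

theorem coeff_single_linSubst_X (A : Matrix (Fin n) (Fin n) K) (a b : Fin n) :
    MvPolynomial.coeff (Finsupp.single b 1) (linSubst A (MvPolynomial.X a)) = A a b := by
  classical
  rw [linSubst_X, MvPolynomial.coeff_sum, Finset.sum_eq_single b]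
  · simp
  · intro c _ hc
    rw [MvPolynomial.coeff_C_mul, MvPolynomial.coeff_X, if_neg, mul_zero]
    exact fun h => hc (Finsupp.single_left_injective one_ne_zero h)
  · simp

theorem coeff_zero_map_X (g : PS n K ≃ₐ[K] PS n K) (a : Fin n) :
    MvPowerSeries.coeff 0 (g (MvPowerSeries.X a)) = 0 :=
  (mem_maxIdeal_iff _).1 (maxIdeal_le_comap g (X_mem_maxIdeal a))

theorem exists_eq_single_of_degree_eq_one {β : Fin n →₀ ℕ} (h : β.degree = 1) :
    ∃ b, β = Finsupp.single b 1 := by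
  have h0 : β ≠ 0 := by rintro rfl; simp at h
  obtain ⟨b, hb⟩ := Finsupp.ne_iff.1 h0
  have hb' : Finsupp.single b 1 ≤ β := by
    rw [Finsupp.single_le_iff]
    exact Nat.one_le_iff_ne_zero.2 hb
  refine ⟨b, ?_⟩
  have hd := congrArg Finsupp.degree (tsub_add_cancel_of_le hb')
  rw [map_add, Finsupp.degree_single, h] at hd
  have : β - Finsupp.single b 1 = 0 := (Finsupp.degree_eq_zero_iff _).1 (by omega)
  rw [← tsub_add_cancel_of_le hb', this, zero_add]

theorem sameLeading_map_X (g : PS n K ≃ₐ[K] PS n K) (a : Fin n) :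
    SameLeading 1 (g (MvPowerSeries.X a))
      (linSubst (linMatrix g) (MvPolynomial.X a) : MvPolynomial (Fin n) K) := by
  constructor
  · intro β hβ
    have : β = 0 := (Finsupp.degree_eq_zero_iff _).1 (by omega)
    subst this
    refine ⟨coeff_zero_map_X g a, ?_⟩
    rw [MvPolynomial.coeff_coe]
    exact (isHomogeneous_linSubst_X _ a).coeff_eq_zero (by simp)
  · intro β hβ
    obtain ⟨b, rfl⟩ := exists_eq_single_of_degree_eq_one hβ
    rw [MvPolynomial.coeff_coe, coeff_single_linSubst_X]
    rfl

/-- Each g(x_a) has no constant term, so lowest-degree forms multiply and only linear parts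
contribute to them. -/
theorem sameLeading_map_monomial (g : PS n K ≃ₐ[K] PS n K) (α : Fin n →₀ ℕ) :
    SameLeading α.degree (g (MvPowerSeries.monomial α 1))
      (linSubst (linMatrix g) (MvPolynomial.monomial α 1) : MvPolynomial (Fin n) K) := by
  rw [map_monomial_eq_prod, coe_linSubst_monomial_eq_prod, Finsupp.degree_eq_sum]
  exact SameLeading.prod _ fun a => by simpa using (sameLeading_map_X g a).pow (α a)

/-- The linear part of an automorphism that preserves a monomial ideal preserves its exponents. -/
theorem preservesExps_linMatrix {I : Ideal (PS n K)} (hI : IsMonomialIdeal I)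
    {g : PS n K ≃ₐ[K] PS n K} (hg : ∀ f ∈ I, g f ∈ I) :
    PreservesExps (exponents I) (linMatrix g) := by
  rw [preservesExps_iff_monomial]
  intro α hα β hβ
  refine (hI.mem_iff _).1 (hg _ hα) β ?_
  have hd : β.degree = α.degree := by
    by_contra h
    exact hβ ((isHomogeneous_linSubst_monomial _ α).coeff_eq_zero h)
  rwa [(sameLeading_map_monomial g α).2 β hd, MvPolynomial.coeff_coe]

theorem map_X_eq_of_isDegreePreserving {g : PS n K ≃ₐ[K] PS n K} (hg : IsDegreePreserving g)
    (a : Fin n) : g (MvPowerSeries.X a) =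
      (linSubst (linMatrix g) (MvPolynomial.X a) : MvPolynomial (Fin n) K) := by
  have hX : (MvPowerSeries.X a : PS n K).IsHomogeneous 1 := by
    classical
    intro β hβ
    rw [MvPowerSeries.coeff_X] at hβ
    split_ifs at hβ with h
    · simp [h, Finsupp.weight_apply]
    · exact absurd rfl hβ
  ext β
  by_cases h : β.degree = 1
  · exact (sameLeading_map_X g a).2 β h
  · rw [MvPowerSeries.IsHomogeneous.coeff_eq_zero (hg 1 _ hX) h, MvPolynomial.coeff_coe,
      (isHomogeneous_linSubst_X _ a).coeff_eq_zero h]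

/-- A degree-preserving automorphism preserves a monomial ideal if its matrix preserves the
exponents. -/
theorem map_mem_of_preservesExps {I : Ideal (PS n K)} (hI : IsMonomialIdeal I)
    {g : PS n K ≃ₐ[K] PS n K} (hg : IsDegreePreserving g)
    (h : PreservesExps (exponents I) (linMatrix g)) {f : PS n K} (hf : f ∈ I) : g f ∈ I := by
  obtain ⟨S, hS⟩ := id hI
  have hle : I ≤ I.comap (g : PS n K →ₐ[K] PS n K) := by
    conv_lhs => rw [hS]
    rw [Ideal.span_le]
    rintro _ ⟨α, hα, rfl⟩
    have hα' : α ∈ exponents I := by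
      change _ ∈ I
      rw [hS]
      exact Ideal.subset_span ⟨α, hα, rfl⟩
    change g (MvPowerSeries.monomial α 1) ∈ I
    have : g (MvPowerSeries.monomial α 1) = (linSubst (linMatrix g) (MvPolynomial.monomial α 1) :
        MvPolynomial (Fin n) K) := by
      rw [map_monomial_eq_prod, coe_linSubst_monomial_eq_prod]
      simp only [map_X_eq_of_isDegreePreserving hg]
    rw [this, hI.mem_iff]
    intro β hβ
    rw [MvPolynomial.coeff_coe] at hβ
    exact preservesExps_iff_monomial.1 h α hα' β hβ
  exact hle hf

/-- An automorphism that maps an ideal of finite colength into itself maps it onto itself. -/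
theorem HasFiniteColength.map_mem_iff {I : Ideal (PS n K)} (hI : HasFiniteColength I)
    {g : PS n K ≃ₐ[K] PS n K} (hg : ∀ f ∈ I, g f ∈ I) (f : PS n K) : g f ∈ I ↔ f ∈ I := by
  refine ⟨fun hf => ?_, hg f⟩
  have : Module.Finite K (PS n K ⧸ I) := hI
  let φ : (PS n K ⧸ I) →ₐ[K] (PS n K ⧸ I) := Ideal.quotientMapₐ I (g : PS n K →ₐ[K] PS n K) hg
  have hφ : ∀ x, φ (Ideal.Quotient.mk I x) = Ideal.Quotient.mk I (g x) := fun x => rfl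
  -- A surjective endomorphism of the finite-dimensional quotient is injective.
  have hsurj : Function.Surjective φ.toLinearMap := by
    intro y
    obtain ⟨y, rfl⟩ := Ideal.Quotient.mk_surjective y
    exact ⟨Ideal.Quotient.mk I (g.symm y), by simp [hφ]⟩
  have hinj := LinearMap.injective_iff_surjective.2 hsurj
  rw [← Ideal.Quotient.eq_zero_iff_mem]
  apply hinj
  rw [AlgHom.toLinearMap_apply, hφ, map_zero, Ideal.Quotient.eq_zero_iff_mem]
  exact hf

end LinearPart

end Alignment

namespace Alignment

/-! ### Coordinate subspaces and the powers of automorphisms that fix them. -/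

section CoordinateSubspaces

variable {n : ℕ} {K : Type*} [Field K]

/-- The subspace of `𝔪 / 𝔪 ^ 2` spanned by the classes of the variables indexed by `D`. -/
noncomputable def coordSpan (K : Type*) [Field K] (D : Set (Fin n)) : Submodule K (Cot n K) :=
  Submodule.span K (varClass '' D)

theorem mem_coordSpan {D : Set (Fin n)} {x : Cot n K} :
    x ∈ coordSpan K D ↔ ∀ b ∉ D, linCoeff x b = 0 := by
  rw [coordSpan, ← coe_varBasis, Module.Basis.mem_span_image]
  constructor
  · intro h b hb
    by_contra h'
    exact hb (h (by simpa [varBasis_repr] using h'))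
  · intro h b hb
    by_contra h'
    have := h b h'
    rw [← varBasis_repr] at this
    simp [this] at hb

theorem varClass_mem_coordSpan {D : Set (Fin n)} {a : Fin n} :
    (varClass a : Cot n K) ∈ coordSpan K D ↔ a ∈ D := by
  rw [mem_coordSpan]
  constructor
  · intro h
    by_contra ha
    have := h a ha
    simp [linCoeff_varClass] at this
  · intro ha b hb
    have : b ≠ a := fun h => hb (h ▸ ha)
    simp [linCoeff_varClass, this]

theorem varClass_ne_zero (a : Fin n) : (varClass a : Cot n K) ≠ 0 := by
  intro h
  have := congrFun (linCoeff_varClass (K := K) a) a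
  simp [h] at this

theorem iSup_coordSpan {ι : Sort*} (D : ι → Set (Fin n)) :
    ⨆ i, coordSpan K (D i) = coordSpan K (⋃ i, D i) := by
  simp only [coordSpan, Set.image_iUnion, Submodule.span_iUnion]

theorem coordSpan_univ : coordSpan K (Set.univ : Set (Fin n)) = ⊤ :=
  eq_top_iff.2 fun _ _ => mem_coordSpan.2 fun b hb => absurd (Set.mem_univ b) hb

theorem disjoint_coordSpan {D E : Set (Fin n)} (h : Disjoint D E) :
    Disjoint (coordSpan K D) (coordSpan K E) := by
  rw [Submodule.disjoint_def]
  intro x hx hy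
  apply linCoeff_bijective.1
  ext b
  rw [map_zero]
  by_cases hb : b ∈ D
  · exact mem_coordSpan.1 hy b (Set.disjoint_left.1 h hb)
  · exact mem_coordSpan.1 hx b hb

theorem eq_sum_linCoeff_smul (x : Cot n K) : x = ∑ b, linCoeff x b • varClass b := by
  conv_lhs => rw [← varBasis.sum_repr x]
  simp only [varBasis_repr, varBasis_apply]

theorem linCoeff_cotMap (g : PS n K ≃ₐ[K] PS n K) (x : Cot n K) (q : Fin n) :
    linCoeff (cotMap g x) q = ∑ p, linCoeff x p * linMatrix g p q := by
  conv_lhs => rw [eq_sum_linCoeff_smul x]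
  simp [Finset.sum_apply, linCoeff_cotMap_varClass]

theorem cotMap_cotMap_inv (g : PS n K ≃ₐ[K] PS n K) (x : Cot n K) :
    cotMap g (cotMap g⁻¹ x) = x := by
  rw [← LinearMap.comp_apply, ← cotMap_mul, mul_inv_cancel, cotMap_one, LinearMap.id_apply]

theorem cotMap_injective (g : PS n K ≃ₐ[K] PS n K) : Function.Injective (cotMap g) := by
  refine Function.LeftInverse.injective (g := cotMap g⁻¹) fun x => ?_
  rw [← LinearMap.comp_apply, ← cotMap_mul, inv_mul_cancel, cotMap_one, LinearMap.id_apply]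

/-- The zero pattern only expresses that the subspace is mapped into itself; equality follows by
comparing dimensions. -/
theorem fixes_coordSpan_iff {g : PS n K ≃ₐ[K] PS n K} {D : Set (Fin n)} :
    Fixes g (coordSpan K D) ↔ ∀ a ∈ D, ∀ b ∉ D, linMatrix g a b = 0 := by
  constructor
  · intro h a ha b hb
    have h1 : cotMap g (varClass a) ∈ coordSpan K D := by
      rw [← h]
      exact Submodule.mem_map_of_mem (varClass_mem_coordSpan.2 ha)
    exact mem_coordSpan.1 h1 b hb
  · intro h
    have : Module.Finite K (Cot n K) := Module.Finite.of_basis varBasis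
    refine Submodule.eq_of_le_of_finrank_eq ?_ ?_
    · conv_lhs => rw [coordSpan]
      rw [Submodule.map_span_le]
      rintro _ ⟨a, ha, rfl⟩
      exact mem_coordSpan.2 fun b hb => h a ha b hb
    · exact (Submodule.equivMapOfInjective _ (cotMap_injective g) _).finrank_eq.symm

/-- Some positive power of `g` fixes the subspace spanned by the variables in `D`. -/
def PowFixes (g : PS n K ≃ₐ[K] PS n K) (D : Set (Fin n)) : Prop :=
  ∃ k : ℕ, 0 < k ∧ Fixes (g ^ k) (coordSpan K D)

theorem Fixes.pow {g : PS n K ≃ₐ[K] PS n K} {V : Submodule K (Cot n K)} (h : Fixes g V) (k : ℕ) :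
    Fixes (g ^ k) V := by
  induction k with
  | zero => rw [pow_zero, Fixes, cotMap_one, Submodule.map_id]
  | succ k ih => rw [pow_succ, Fixes, cotMap_mul, Submodule.map_comp, h, ih]

theorem PowFixes.exists_common {g : PS n K ≃ₐ[K] PS n K} {D E : Set (Fin n)} (hD : PowFixes g D)
    (hE : PowFixes g E) :
    ∃ k : ℕ, 0 < k ∧ Fixes (g ^ k) (coordSpan K D) ∧ Fixes (g ^ k) (coordSpan K E) := by
  obtain ⟨k, hk, h⟩ := hD
  obtain ⟨l, hl, h'⟩ := hE
  refine ⟨k * l, Nat.mul_pos hk hl, ?_, ?_⟩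
  · rw [pow_mul]; exact h.pow l
  · rw [mul_comm, pow_mul]; exact h'.pow k

theorem PowFixes.inter {g : PS n K ≃ₐ[K] PS n K} {D E : Set (Fin n)} (hD : PowFixes g D)
    (hE : PowFixes g E) : PowFixes g (D ∩ E) := by
  obtain ⟨k, hk, h, h'⟩ := hD.exists_common hE
  refine ⟨k, hk, ?_⟩
  rw [fixes_coordSpan_iff] at h h' ⊢
  intro a ha b hb
  by_cases hbD : b ∈ D
  · exact h' a ha.2 b fun hbE => hb ⟨hbD, hbE⟩
  · exact h a ha.1 b hbD

theorem PowFixes.union {g : PS n K ≃ₐ[K] PS n K} {D E : Set (Fin n)} (hD : PowFixes g D)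
    (hE : PowFixes g E) : PowFixes g (D ∪ E) := by
  obtain ⟨k, hk, h, h'⟩ := hD.exists_common hE
  refine ⟨k, hk, ?_⟩
  rw [fixes_coordSpan_iff] at h h' ⊢
  rintro a (ha | ha) b hb
  · exact h a ha b fun hbD => hb (Or.inl hbD)
  · exact h' a ha b fun hbE => hb (Or.inr hbE)

theorem PowFixes.empty (g : PS n K ≃ₐ[K] PS n K) : PowFixes g ∅ :=
  ⟨1, one_pos, fixes_coordSpan_iff.2 fun _ ha => absurd ha (Set.notMem_empty _)⟩

theorem PowFixes.univ (g : PS n K ≃ₐ[K] PS n K) : PowFixes g Set.univ :=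
  ⟨1, one_pos, fixes_coordSpan_iff.2 fun _ _ b hb => absurd (Set.mem_univ b) hb⟩

end CoordinateSubspaces

/-! ### Closed sets of variables, and the refinement of decompositions. -/

section Stabilizer

variable {n r : ℕ} {K : Type*} [Field K] {I : Fin r → Ideal (PS n K)}

theorem movesTo_of_linMatrix (hmon : ∀ j, IsMonomialIdeal (I j)) {g : PS n K ≃ₐ[K] PS n K}
    (hg : g ∈ idealStabilizer I) {p q p' : Fin n} (hp : linMatrix g p q ≠ 0)
    (hq : linMatrix g⁻¹ q p' ≠ 0) (j : Fin r) : MovesTo K (exponents (I j)) p p' := by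
  refine movesTo_of_conj (A := linMatrix g) (B := linMatrix g⁻¹) ?_ ?_ ?_ hp hq
  · rw [← linMatrix_mul, inv_mul_cancel, linMatrix_one]
  · exact preservesExps_linMatrix (hmon j) fun f hf => (hg j f).2 hf
  · exact preservesExps_linMatrix (hmon j) fun f hf => (inv_mem hg j f).2 hf

/-- Elements of the stabilizer map coordinate subspaces that are closed under all the moves
preserving the ideals to coordinate subspaces. -/
theorem exists_map_coordSpan_eq (hmon : ∀ j, IsMonomialIdeal (I j)) {g : PS n K ≃ₐ[K] PS n K}
    (hg : g ∈ idealStabilizer I) {D : Set (Fin n)}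
    (hD : ∀ a ∈ D, ∀ b, (∀ j, MovesTo K (exponents (I j)) a b) → b ∈ D) :
    ∃ E : Set (Fin n), (coordSpan K D).map (cotMap g) = coordSpan K E := by
  -- It suffices that every variable x_q occurring in some g(u), with u in the span of `D`, lies in
  -- the image. Such a q is reached from some p in `D`, and any p' occurring in g⁻¹(x_q) then
  -- satisfies p → p', so p' is in `D`.
  refine ⟨{q | varClass q ∈ (coordSpan K D).map (cotMap g)}, le_antisymm ?_ ?_⟩
  · rintro _ ⟨u, hu, rfl⟩
    rw [mem_coordSpan]
    intro q hq
    by_contra hne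
    refine hq ?_
    change varClass q ∈ (coordSpan K D).map (cotMap g)
    rw [← Submodule.smul_mem_iff _ hne]
    refine ⟨linCoeff (cotMap g u) q • cotMap g⁻¹ (varClass q), ?_, ?_⟩
    · refine mem_coordSpan.2 fun p' hp' => ?_
      rw [map_smul, Pi.smul_apply, linCoeff_cotMap_varClass, smul_eq_mul, linCoeff_cotMap,
        Finset.sum_mul]
      refine Finset.sum_eq_zero fun p _ => ?_
      by_contra h
      have h1 := right_ne_zero_of_mul (left_ne_zero_of_mul h)
      have h2 := left_ne_zero_of_mul (left_ne_zero_of_mul h)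
      have h3 : p ∈ D := by
        by_contra h4
        exact h2 (mem_coordSpan.1 hu p h4)
      exact hp' (hD p h3 p' (movesTo_of_linMatrix hmon hg h1 (right_ne_zero_of_mul h)))
    · rw [map_smul, cotMap_cotMap_inv]
  · rw [coordSpan, Submodule.span_le]
    rintro _ ⟨q, hq, rfl⟩
    exact hq

theorem powFixes_of_closed (hmon : ∀ j, IsMonomialIdeal (I j)) {g : PS n K ≃ₐ[K] PS n K}
    (hg : g ∈ idealStabilizer I) {D : Set (Fin n)}
    (hD : ∀ a ∈ D, ∀ b, (∀ j, MovesTo K (exponents (I j)) a b) → b ∈ D) : PowFixes g D := by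
  choose E hE using fun k : ℕ => exists_map_coordSpan_eq hmon (pow_mem hg k) hD
  -- Pigeonhole: there are only finitely many sets of variables.
  obtain ⟨k, l, hkl, heq⟩ : ∃ k l, k < l ∧ E k = E l := by
    obtain ⟨k, l, hne, heq⟩ := Finite.exists_ne_map_eq_of_infinite E
    rcases lt_or_gt_of_ne hne with h | h
    · exact ⟨k, l, h, heq⟩
    · exact ⟨l, k, h, heq.symm⟩
  refine ⟨l - k, Nat.sub_pos_of_lt hkl, ?_⟩
  apply Submodule.map_injective_of_injective (cotMap_injective (g ^ k))
  rw [← Submodule.map_comp, ← cotMap_mul, ← pow_add, Nat.add_sub_cancel' hkl.le, hE, hE, heq]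

/-- An adapted decomposition is given by a partition of the variables. -/
theorem IsAdapted.exists_level {m : ℕ} {W : Fin m → Submodule K (Cot n K)} (hW : IsAdapted I W) :
    ∃ ℓ : Fin n → Fin m, Function.Surjective ℓ ∧ ∀ i, W i = coordSpan K (ℓ ⁻¹' {i}) := by
  choose S hS using hW.spanned
  replace hS : ∀ i, W i = coordSpan K (S i) := hS
  have hcover : ∀ a, ∃ i, a ∈ S i := by
    intro a
    have htop := hW.isInternal.submodule_iSup_eq_top
    rw [funext hS, iSup_coordSpan] at htop
    have : (varClass a : Cot n K) ∈ coordSpan K (⋃ i, S i) := htop ▸ Submodule.mem_top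
    exact Set.mem_iUnion.1 (varClass_mem_coordSpan.1 this)
  choose ℓ hℓ using hcover
  have huniq : ∀ a i, a ∈ S i → ℓ a = i := by
    intro a i ha
    by_contra hne
    have hdis := hW.isInternal.submodule_iSupIndep.pairwiseDisjoint hne
    simp only [Function.onFun, hS] at hdis
    exact varClass_ne_zero a (Submodule.disjoint_def.1 hdis _ (varClass_mem_coordSpan.2 (hℓ a))
      (varClass_mem_coordSpan.2 ha))
  have hSℓ : ∀ i, S i = ℓ ⁻¹' {i} := by
    intro i
    ext a
    exact ⟨huniq a i, fun h => h ▸ hℓ a⟩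
  refine ⟨ℓ, fun i => ?_, fun i => by rw [hS, hSℓ]⟩
  by_contra hno
  refine hW.ne_bot i ?_
  have : S i = ∅ := Set.eq_empty_of_forall_notMem fun a ha => hno ⟨a, huniq a i ha⟩
  rw [hS, this, coordSpan, Set.image_empty, Submodule.span_empty]

theorem iSup_coordSpan_level {m : ℕ} (ℓ : Fin n → Fin m) (i : Fin m) :
    ⨆ j ≤ i, coordSpan K (ℓ ⁻¹' {j}) = coordSpan K {a | ℓ a ≤ i} := by
  simp only [iSup_coordSpan]
  congr 1
  ext a
  simp

theorem isAdapted_of_level {m : ℕ} {ℓ : Fin n → Fin m} (hsurj : Function.Surjective ℓ)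
    (h : ∀ i, ∀ g ∈ idealStabilizer I, PowFixes g {a | ℓ a ≤ i}) :
    IsAdapted I fun i => coordSpan K (ℓ ⁻¹' {i}) where
  isInternal := by
    refine DirectSum.isInternal_submodule_of_iSupIndep_of_iSup_eq_top ?_ ?_
    · intro i
      change Disjoint (coordSpan K _) (⨆ j, ⨆ (_ : j ≠ i), coordSpan K (ℓ ⁻¹' {j}))
      simp only [iSup_coordSpan]
      refine disjoint_coordSpan (Set.disjoint_left.2 fun a ha hb => ?_)
      simp only [Set.mem_iUnion] at hb
      obtain ⟨j, hj, hb⟩ := hb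
      exact hj (hb.symm.trans ha)
    · rw [iSup_coordSpan, ← coordSpan_univ]
      congr 1
      ext a
      simp
  ne_bot i hi := by
    obtain ⟨a, rfl⟩ := hsurj i
    have : (varClass a : Cot n K) ∈ coordSpan K (ℓ ⁻¹' {ℓ a}) := varClass_mem_coordSpan.2 rfl
    rw [hi] at this
    exact varClass_ne_zero a this
  spanned i := ⟨_, rfl⟩
  partialSum_fixed i g hg := by
    rw [iSup_coordSpan_level]
    exact h i g hg

/-- In a decomposition with the largest number of summands, the variables in a summand move to
each other. -/
theorem movesTo_of_level_eq (hmon : ∀ j, IsMonomialIdeal (I j)) {m : ℕ} {ℓ : Fin n → Fin m}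
    (hsurj : Function.Surjective ℓ)
    (hfix : ∀ i, ∀ g ∈ idealStabilizer I, PowFixes g {a | ℓ a ≤ i})
    (hmax : ∀ (m' : ℕ) (W' : Fin m' → Submodule K (Cot n K)), IsAdapted I W' → m' ≤ m)
    {a c : Fin n} (hac : ℓ a = ℓ c) (j : Fin r) : MovesTo K (exponents (I j)) a c := by
  classical
  revert j
  by_contra hnot
  -- The upward closure of `a`; it contains `a` but not `c`, so it cuts their common level properly.
  let D : Set (Fin n) := {d | ∀ j, MovesTo K (exponents (I j)) a d}
  have haD : a ∈ D := fun j => .refl _ a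
  have hcD : c ∉ D := hnot
  have hD : ∀ g ∈ idealStabilizer I, PowFixes g D := fun g hg =>
    powFixes_of_closed hmon hg fun b hb d hd j => (hb j).trans (hd j)
  have hlt : ∀ s : ℕ, ∀ g ∈ idealStabilizer I, PowFixes g {x | (ℓ x : ℕ) < s} := by
    intro s g hg
    rcases Nat.eq_zero_or_pos s with rfl | hs
    · convert PowFixes.empty g using 1
      ext x
      simp
    · rcases le_or_gt s m with hsm | hsm
      · convert hfix ⟨s - 1, by omega⟩ g hg using 1
        ext x
        simp only [Set.mem_ofPred_eq, Fin.le_def]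
        omega
      · convert PowFixes.univ g using 1
        ext x
        simp only [Set.mem_ofPred_eq, Set.mem_univ, iff_true]
        omega
  -- The level of `a` is split in two, with its part in `D` first; all higher levels shift up by
  -- one.
  let ℓ' : Fin n → Fin (m + 1) := fun x =>
    if ℓ x < ℓ a ∨ (ℓ x = ℓ a ∧ x ∈ D) then (ℓ x).castSucc else (ℓ x).succ
  have hval : ∀ x, (ℓ' x : ℕ) =
      if (ℓ x : ℕ) < ℓ a ∨ ((ℓ x : ℕ) = ℓ a ∧ x ∈ D) then (ℓ x : ℕ) else ℓ x + 1 := by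
    intro x
    simp only [ℓ', Fin.lt_def, Fin.ext_iff]
    split_ifs <;> simp
  have hsurj' : Function.Surjective ℓ' := by
    intro t
    rcases lt_trichotomy (t : ℕ) (ℓ a) with h | h | h
    · obtain ⟨x, hx⟩ := hsurj ⟨t, by omega⟩
      have hx' : (ℓ x : ℕ) = t := by rw [hx]
      refine ⟨x, Fin.ext ?_⟩
      rw [hval, if_pos (Or.inl (by omega)), hx']
    · refine ⟨a, Fin.ext ?_⟩
      rw [hval, if_pos (Or.inr ⟨rfl, haD⟩), h]
    · rcases eq_or_ne (t : ℕ) (ℓ a + 1) with h' | h'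
      · refine ⟨c, Fin.ext ?_⟩
        rw [hval, if_neg, ← hac, h']
        rw [← hac]
        rintro (h1 | h1)
        · exact lt_irrefl _ h1
        · exact hcD h1.2
      · obtain ⟨x, hx⟩ := hsurj ⟨t - 1, by omega⟩
        have hx' : (ℓ x : ℕ) = t - 1 := by rw [hx]
        refine ⟨x, Fin.ext ?_⟩
        rw [hval, if_neg (by omega)]
        omega
  have hfix' : ∀ t, ∀ g ∈ idealStabilizer I, PowFixes g {x | ℓ' x ≤ t} := by
    intro t g hg
    rcases lt_trichotomy (t : ℕ) (ℓ a) with h | h | h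
    · convert hlt (t + 1) g hg using 1
      ext x
      simp only [Set.mem_ofPred_eq, Fin.le_def, hval]
      split_ifs <;> omega
    -- The only new partial sum: all lower levels together with the part of the split level in `D`.
    · convert (hlt (ℓ a) g hg).union ((hlt (ℓ a + 1) g hg).inter (hD g hg)) using 1
      ext x
      simp only [Set.mem_ofPred_eq, Fin.le_def, hval, Set.mem_union, Set.mem_inter_iff]
      by_cases hx : x ∈ D
      · simp only [hx, and_true]
        split_ifs <;> omega
      · simp only [hx, and_false, or_false]
        split_ifs <;> omega
    · convert hlt t g hg using 1
      ext x
      simp only [Set.mem_ofPred_eq, Fin.le_def, hval]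
      split_ifs <;> omega
  have := hmax _ _ (isAdapted_of_level hsurj' hfix')
  omega

end Stabilizer

end Alignment

/-! ### The main theorem. -/

theorem lemma3p2 {K : Type*} [Field K] {n r m : ℕ}
    (I : Fin r → Ideal (Alignment.PS n K))
    (hmon : ∀ j, Alignment.IsMonomialIdeal (I j))
    (hcol : ∀ j, Alignment.HasFiniteColength (I j))
    (W : Fin m → Submodule K (Alignment.Cot n K))
    (hW : Alignment.IsAdapted I W)
    (hmax : ∀ (m' : ℕ) (W' : Fin m' → Submodule K (Alignment.Cot n K)),
      Alignment.IsAdapted I W' → m' ≤ m)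
    (g : Alignment.PS n K ≃ₐ[K] Alignment.PS n K)
    (hdeg : Alignment.IsDegreePreserving g)
    (hfix : ∀ i, Alignment.Fixes g (W i)) :
    g ∈ Alignment.idealStabilizer I := by
  obtain ⟨ℓ, hsurj, hℓ⟩ := hW.exists_level
  have hpow : ∀ i, ∀ h ∈ Alignment.idealStabilizer I, Alignment.PowFixes h {a | ℓ a ≤ i} := by
    intro i h hh
    have := hW.partialSum_fixed i h hh
    simp only [hℓ, Alignment.iSup_coordSpan_level] at this
    exact this
  -- Fixing every summand, not just the partial sums, makes the matrix of `g` block diagonal rather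
  -- than block triangular.
  have hblock : ∀ a b, Alignment.linMatrix g a b ≠ 0 → ℓ a = ℓ b := by
    intro a b hab
    by_contra hne
    have := hfix (ℓ a)
    rw [hℓ, Alignment.fixes_coordSpan_iff] at this
    exact hab (this a rfl b fun h => hne h.symm)
  intro j
  refine (hcol j).map_mem_iff fun f hf => ?_
  refine Alignment.map_mem_of_preservesExps (hmon j) hdeg ?_ hf
  exact Alignment.preservesExps_of_blockDiagonal ℓ
    (fun a b hab => Alignment.movesTo_of_level_eq hmon hsurj hpow hmax hab j) hblock
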